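/- Let $X$ be a simplicial complex, $Y\subseteq X$ a subcomplex, and $S$ a set of (nonempty) simplices of $X$ satisfying the following conditions. (i) A simplex $\sigma$ of $X$ is a simplex of $Y$ if and only if no face of $\sigma$ (including $\sigma$ itself) is in $S$. (ii) If $\sigma$ and $\tau$ are distinct simplices in $S$, then the union of their vertex sets does not form a simplex of $X$. Then there is a homotopy equivalence $$X/Y \;\simeq\; \bigvee_{\sigma\in S}\Sigma^{\dim(\sigma)+1}\bigl(\mathrm{Link}_X(\sigma)\bigr).$$ Here simplicial complexes, which need not be finite or locally finite, are identified with their geometric realizations in the weak topology; $\mathrm{Link}_X(\sigma)$ is the (possibly empty) complex of the simplices of $X$ that are disjoint from $\sigma$ and whose vertices together with those of $\sigma$ form a simplex of $X$; $\Sigma$ is the unreduced suspension, with one of the two poles as base point and $\Sigma\emptyset=S^0$; $X/\emptyset$ is $X$ with a disjoint base point; and the wedge over the empty set is a point. -/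

import Mathlib

universe u

namespace PreAbstractSimplicialComplex

variable {V : Type u}

/-- The dimension of a simplex, given by its (nonempty) finite set of vertices. -/
def simplexDim (s : Finset V) : ℕ := s.card - 1

/-- The link of `s` in `K`: the simplices of `K` that are disjoint from `s` and whose union with
`s` is a simplex of `K`. It may be the empty complex. -/
def link [DecidableEq V] (K : PreAbstractSimplicialComplex V) (s : Finset V) :
    PreAbstractSimplicialComplex V where
  faces := {t | t ∈ K.faces ∧ Disjoint t s ∧ t ∪ s ∈ K.faces}
  isRelLowerSet_faces := by
    rintro t ⟨htK, hdisj, hunion⟩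
    refine ⟨(K.isRelLowerSet_faces htK).1, fun r hrt hr => ⟨?_, ?_, ?_⟩⟩
    · exact (K.isRelLowerSet_faces htK).2 hrt hr
    · exact hdisj.mono_left hrt
    · exact (K.isRelLowerSet_faces hunion).2 (Finset.union_subset_union_left hrt)
        (hr.mono Finset.subset_union_left)

/-- The closed geometric simplex with vertex set `s`, in barycentric coordinates. -/
def closedSimplex (s : Finset V) : Set (V → ℝ) :=
  {x | (∀ v, 0 ≤ x v) ∧ (∀ v, v ∉ s → x v = 0) ∧ ∑ v ∈ s, x v = 1}

/-- The underlying set of the geometric realization: the union of the closed simplices. -/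
def support (K : PreAbstractSimplicialComplex V) : Set (V → ℝ) :=
  {x | ∃ s ∈ K.faces, x ∈ closedSimplex s}

/-- The geometric realization of a simplicial complex. It does not carry the subspace topology of
`V → ℝ`, but the weak topology defined below. -/
def Realization (K : PreAbstractSimplicialComplex V) : Type u := {x : V → ℝ // x ∈ K.support}

/-- The inclusion of a closed simplex of `K` into the geometric realization. -/
def simplexInclusion (K : PreAbstractSimplicialComplex V) (s : K.faces)
    (x : closedSimplex s.1) : K.Realization :=
  ⟨x.1, s.1, s.2, x.2⟩

/-- The weak (coherent) topology: a set is open if and only if its intersection with every closed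
simplex is open in that simplex, which has its Euclidean topology. -/
instance (K : PreAbstractSimplicialComplex V) : TopologicalSpace K.Realization :=
  ⨆ s : K.faces, TopologicalSpace.coinduced (K.simplexInclusion s) inferInstance

/-- The points of the geometric realization of `K` that lie in that of a subcomplex `L`. -/
def subRealization (K L : PreAbstractSimplicialComplex V) : Set K.Realization :=
  {x | x.1 ∈ L.support}

end PreAbstractSimplicialComplex

/-- The gluing relation on `B ⊔ {*}` that identifies every point of `A` with `*`. -/
inductive CollapseRel {B : Type u} (A : Set B) : B ⊕ Unit → B ⊕ Unit → Prop
  | glue (a : B) (ha : a ∈ A) : CollapseRel A (Sum.inl a) (Sum.inr ())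

/-- The quotient space `B / A`, the pushout of `B ← A → *`, with the quotient topology.
For nonempty `A` this is `B` with `A` collapsed to a point; `B / ∅` is `B` with a disjoint base
point. -/
def Collapse {B : Type u} (A : Set B) : Type u := Quot (CollapseRel A)

instance {B : Type u} [TopologicalSpace B] (A : Set B) : TopologicalSpace (Collapse A) :=
  inferInstanceAs (TopologicalSpace (Quot (CollapseRel A)))

/-- The wedge of a family of pointed spaces: their disjoint union with all base points
identified. The empty wedge is a point. -/
abbrev Wedge {ι : Type u} (Z : ι → Type u) (p : ∀ i, Z i) : Type u :=
  Collapse (Set.range fun i => (⟨i, p i⟩ : Σ i, Z i))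

/-- The gluing relation on `L × [0,1] ⊔ {south, north}` that identifies `L × {0}` with the south
pole (`false`) and `L × {1}` with the north pole (`true`). -/
inductive SuspensionRel (L : Type u) : (L × unitInterval) ⊕ Bool → (L × unitInterval) ⊕ Bool → Prop
  | south (x : L) : SuspensionRel L (Sum.inl (x, 0)) (Sum.inr false)
  | north (x : L) : SuspensionRel L (Sum.inl (x, 1)) (Sum.inr true)

/-- The unreduced suspension; the suspension of the empty space is the two-point space `S⁰`. -/
def suspension (L : TopCat.{u}) : TopCat.{u} := TopCat.of (Quot (SuspensionRel L))

/-- The south pole of the suspension, used as its base point. -/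
def southPole (L : TopCat.{u}) : suspension L := Quot.mk (SuspensionRel L) (Sum.inr false)

/-- The iterated unreduced suspension. -/
def iteratedSuspension : ℕ → TopCat.{u} → TopCat.{u}
  | 0, L => L
  | n + 1, L => suspension (iteratedSuspension n L)

open Set Topology

namespace PreAbstractSimplicialComplex

variable {V : Type u}

/-! The two spaces are even homeomorphic. For `σ ∈ S` the closed star of `σ` is the cone, with apex
the barycenter of `σ`, over the join `∂σ * Link σ`. By (ii) a simplex of `X` contains at most one
member of `S`; hence no simplex of `∂σ * Link σ` contains a member of `S`, and by (i) this join lies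
in `Y`. Again by (i), every simplex outside `Y` contains some `σ ∈ S`. So `X` is `Y` with cones
attached along their bases, disjoint outside `Y`, and `X / Y` is the wedge of these cones with bases
collapsed, that is, of the suspensions of `∂σ * Link σ` (`nonempty_wedge_homeomorph`).

It remains to see that `∂σ * L` is the `dim σ`-fold suspension of `L = Link σ`. For `ρ ⊆ σ` and a
further vertex `v` of `σ`, `∂(ρ ∪ {v}) * L` is the union of two cones over `∂ρ * L`, with apexes `v`
and the barycenter of `ρ`, meeting only in their common base. Induction on `ρ` starts at a single
vertex, where `∂ρ * L = L` (`nonempty_suspension_homeomorph`).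

Both homeomorphisms are built from `coneMap`; `isHomeomorph_of_compact_cover` gives continuity of
the inverse without local finiteness. -/

/-! ### Closed simplices and conical coordinates -/

theorem closedSimplex_mono {s t : Finset V} (h : s ⊆ t) : closedSimplex s ⊆ closedSimplex t := by
  rintro x ⟨h0, hs, h1⟩
  refine ⟨h0, fun v hv => hs v fun hvs => hv (h hvs), ?_⟩
  rw [← h1]
  exact (Finset.sum_subset h fun v _ hv => hs v hv).symm

theorem le_one_of_mem_closedSimplex {s : Finset V} {x : V → ℝ} (hx : x ∈ closedSimplex s) (v : V) :
    x v ≤ 1 := by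
  by_cases hv : v ∈ s
  · rw [← hx.2.2]
    exact Finset.single_le_sum (fun w _ => hx.1 w) hv
  · rw [hx.2.1 v hv]
    exact zero_le_one

theorem isCompact_closedSimplex (s : Finset V) : IsCompact (closedSimplex s) := by
  have hc : IsCompact (Set.pi univ fun _ : V => Icc (0 : ℝ) 1) :=
    isCompact_univ_pi fun _ => isCompact_Icc
  refine hc.of_isClosed_subset ?_ fun x hx v _ => ⟨hx.1 v, le_one_of_mem_closedSimplex hx v⟩
  simp only [closedSimplex, ofPred_and, ofPred_forall]
  refine (isClosed_iInter fun v => isClosed_le continuous_const (continuous_apply v)).inter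
    (.inter ?_ (isClosed_eq (by fun_prop) continuous_const))
  exact isClosed_iInter fun v => isClosed_iInter fun _ =>
    isClosed_eq (continuous_apply v) continuous_const

instance (s : Finset V) : CompactSpace (closedSimplex s) :=
  isCompact_iff_compactSpace.1 (isCompact_closedSimplex s)

theorem mem_closedSimplex_union [DecidableEq V] {s t : Finset V} {a b : V → ℝ}
    (ha : a ∈ closedSimplex s) (hb : b ∈ closedSimplex t) (r : unitInterval) :
    (r : ℝ) • b + (1 - (r : ℝ)) • a ∈ closedSimplex (s ∪ t) := by
  have ha' := closedSimplex_mono (Finset.subset_union_left (s₁ := s) (s₂ := t)) ha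
  have hb' := closedSimplex_mono (Finset.subset_union_right (s₁ := s) (s₂ := t)) hb
  refine ⟨fun v => ?_, fun v hv => ?_, ?_⟩
  · have := mul_nonneg r.2.1 (hb.1 v)
    have := mul_nonneg (sub_nonneg.2 r.2.2) (ha.1 v)
    simp only [Pi.add_apply, Pi.smul_apply, smul_eq_mul]
    linarith
  · simp [ha'.2.1 v hv, hb'.2.1 v hv]
  · simp only [Pi.add_apply, Pi.smul_apply, smul_eq_mul]
    rw [Finset.sum_add_distrib, ← Finset.mul_sum, ← Finset.mul_sum, ha'.2.2, hb'.2.2]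
    ring

open Classical in
/-- The barycenter of the simplex with vertex set `s`. -/
noncomputable def barycenter (s : Finset V) : V → ℝ := fun v => if v ∈ s then (s.card : ℝ)⁻¹ else 0

theorem barycenter_of_mem {s : Finset V} {v : V} (hv : v ∈ s) :
    barycenter s v = (s.card : ℝ)⁻¹ := if_pos hv

theorem barycenter_of_notMem {s : Finset V} {v : V} (hv : v ∉ s) : barycenter s v = 0 := if_neg hv

theorem barycenter_pos {s : Finset V} {v : V} (hv : v ∈ s) : 0 < barycenter s v := by
  rw [barycenter_of_mem hv]
  exact inv_pos.2 (Nat.cast_pos.2 (Finset.card_pos.2 ⟨v, hv⟩))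

theorem barycenter_mem {s : Finset V} (hs : s.Nonempty) : barycenter s ∈ closedSimplex s := by
  refine ⟨fun v => ?_, fun v hv => barycenter_of_notMem hv, ?_⟩
  · by_cases hv : v ∈ s
    · exact (barycenter_pos hv).le
    · exact (barycenter_of_notMem hv).ge
  · rw [Finset.sum_congr rfl fun v hv => barycenter_of_mem hv]
    have : (s.card : ℝ) ≠ 0 := Nat.cast_ne_zero.2 hs.card_pos.ne'
    simp [this]

/-- Uniqueness of the coordinates `(a, t)` of a point `t • barycenter ρ + (1 - t) • a` with `a` on
the boundary of the cone. -/
theorem cone_coord_unique {ρ : Finset V} {a a' : V → ℝ} (ha : ∀ v, 0 ≤ a v) (ha' : ∀ v, 0 ≤ a' v)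
    (hz : ∃ v ∈ ρ, a v = 0) (hz' : ∃ v ∈ ρ, a' v = 0) {t t' : ℝ} (ht1 : t < 1) (ht1' : t' ≤ 1)
    (h : t • barycenter ρ + (1 - t) • a = t' • barycenter ρ + (1 - t') • a') :
    t = t' ∧ a = a' := by
  have key : ∀ v, t * barycenter ρ v + (1 - t) * a v = t' * barycenter ρ v + (1 - t') * a' v :=
    fun v => congrFun h v
  have htt : t = t' := by
    -- At a vertex of `ρ` where `a` vanishes the equation gives `t ≥ t'`; at one where `a'` vanishes
    -- it gives `t ≤ t'`.
    obtain ⟨v, hv, hv0⟩ := hz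
    obtain ⟨w, hw, hw0⟩ := hz'
    have h1 := key v
    have h2 := key w
    have := mul_nonneg (sub_nonneg.2 ht1') (ha' v)
    have := mul_nonneg (sub_nonneg.2 ht1.le) (ha w)
    have hb := barycenter_pos hv
    rw [hv0, barycenter_of_mem hv] at h1
    rw [hw0, barycenter_of_mem hw] at h2
    rw [barycenter_of_mem hv] at hb
    exact le_antisymm (le_of_mul_le_mul_right (by linarith) hb)
      (le_of_mul_le_mul_right (by linarith) hb)
  subst htt
  refine ⟨rfl, funext fun v => ?_⟩
  have h1 := key v
  exact mul_left_cancel₀ (sub_pos.2 ht1).ne' (by linarith)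

/-- Every point of a simplex containing `ρ` lies on a segment from the barycenter of `ρ` to a face
opposite to a vertex of `ρ`. -/
theorem exists_cone_coord [DecidableEq V] {ρ s : Finset V} (hρ : ρ.Nonempty) (hρs : ρ ⊆ s)
    {x : V → ℝ} (hx : x ∈ closedSimplex s) :
    x = barycenter ρ ∨ ∃ v ∈ ρ, ∃ a ∈ closedSimplex (s.erase v), ∃ t : unitInterval,
      x = (t : ℝ) • barycenter ρ + (1 - (t : ℝ)) • a := by
  -- With `v` minimizing `x` on `ρ`, `t = |ρ| * x v` is the largest multiple of the barycenter that
  -- can be subtracted from `x` keeping coordinates nonnegative. The remainder vanishes at `v` and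
  -- has total mass `1 - t`; rescaled, it is `a`, unless `t = 1`.
  obtain ⟨v, hv, hmin⟩ := ρ.exists_min_image x hρ
  have hc : 0 < (ρ.card : ℝ) := Nat.cast_pos.2 hρ.card_pos
  have ht1 : ρ.card * x v ≤ 1 := by
    calc ρ.card * x v = ∑ w ∈ ρ, x v := by simp
      _ ≤ ∑ w ∈ ρ, x w := Finset.sum_le_sum hmin
      _ ≤ ∑ w ∈ s, x w := Finset.sum_le_sum_of_subset_of_nonneg hρs fun w _ _ => hx.1 w
      _ = 1 := hx.2.2
  have ht0 : 0 ≤ ρ.card * x v := mul_nonneg hc.le (hx.1 v)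
  set t : ℝ := ρ.card * x v with ht
  have hb := closedSimplex_mono hρs (barycenter_mem hρ)
  have hge : ∀ w, 0 ≤ x w - t * barycenter ρ w := by
    intro w
    by_cases hw : w ∈ ρ
    · rw [barycenter_of_mem hw, ht, mul_comm (ρ.card : ℝ), mul_assoc, mul_inv_cancel₀ hc.ne',
        mul_one]
      exact sub_nonneg.2 (hmin w hw)
    · rw [barycenter_of_notMem hw]
      simpa using hx.1 w
  have hsum : ∑ w ∈ s, (x w - t * barycenter ρ w) = 1 - t := by
    rw [Finset.sum_sub_distrib, ← Finset.mul_sum, hx.2.2, hb.2.2, mul_one]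
  have hoff : ∀ w, w ∉ s → x w - t * barycenter ρ w = 0 := fun w hw => by
    rw [hx.2.1 w hw, hb.2.1 w hw]
    simp
  have hv0 : x v - t * barycenter ρ v = 0 := by
    rw [barycenter_of_mem hv, ht, mul_comm (ρ.card : ℝ), mul_assoc, mul_inv_cancel₀ hc.ne',
      mul_one, sub_self]
  rcases ht1.lt_or_eq with hlt | heq
  · refine .inr ⟨v, hv, fun w => (1 - t)⁻¹ * (x w - t * barycenter ρ w), ⟨fun w => ?_, ?_, ?_⟩,
      ⟨t, ht0, ht1⟩, ?_⟩
    · exact mul_nonneg (inv_nonneg.2 (sub_nonneg.2 ht1)) (hge w)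
    · intro w hw
      rw [Finset.mem_erase, not_and_or, not_not] at hw
      rcases hw with rfl | hw
      · simp [hv0]
      · simp [hoff w hw]
    · rw [← Finset.mul_sum, Finset.sum_erase (f := fun w => x w - t * barycenter ρ w) _ hv0, hsum, inv_mul_cancel₀ (sub_pos.2 hlt).ne']
    · ext w
      simp only [Pi.add_apply, Pi.smul_apply, smul_eq_mul]
      rw [mul_inv_cancel_left₀ (sub_pos.2 hlt).ne']
      ring
  · left
    rw [sub_eq_zero.2 heq.symm, Finset.sum_eq_zero_iff_of_nonneg fun w _ => hge w] at hsum
    ext w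
    by_cases hw : w ∈ s
    · have := hsum w hw
      rw [heq] at this
      linarith
    · rw [hx.2.1 w hw, hb.2.1 w hw]

/-! ### The weak topology -/

variable {K : PreAbstractSimplicialComplex V}

theorem continuous_simplexInclusion (s : K.faces) : Continuous (K.simplexInclusion s) :=
  continuous_iSup_rng (i := s) continuous_coinduced_rng

theorem continuous_realization {Z : Type*} [TopologicalSpace Z] {f : K.Realization → Z}
    (h : ∀ s, Continuous (f ∘ K.simplexInclusion s)) : Continuous f :=
  continuous_iSup_dom.2 fun s => continuous_coinduced_dom.2 (h s)

theorem isClosed_realization {C : Set K.Realization}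
    (h : ∀ s, IsClosed (K.simplexInclusion s ⁻¹' C)) : IsClosed C :=
  isClosed_iSup_iff.2 fun s => isClosed_coinduced.2 (h s)

theorem continuous_realization_val : Continuous fun x : K.Realization => x.1 :=
  continuous_realization fun _ => continuous_subtype_val

instance : T2Space K.Realization :=
  T2Space.of_injective_continuous Subtype.val_injective continuous_realization_val

/-- Currying turns `f` into a map to `C(W, Z)`, whose continuity can be tested on simplices; local
compactness of `W` allows uncurrying. It is applied with `W = [0,1]`. -/
theorem continuous_realization_prod {Z W : Type*} [TopologicalSpace Z] [TopologicalSpace W]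
    [LocallyCompactSpace W] {f : K.Realization × W → Z}
    (h : ∀ s, Continuous fun p : closedSimplex s.1 × W => f (K.simplexInclusion s p.1, p.2)) :
    Continuous f := by
  have hc : ∀ x, Continuous fun w => f (x, w) := by
    rintro ⟨x, s, hs, hx⟩
    exact (h ⟨s, hs⟩).comp (Continuous.prodMk_right (⟨x, hx⟩ : closedSimplex s))
  let g : K.Realization → C(W, Z) := fun x => ⟨fun w => f (x, w), hc x⟩
  have hg : Continuous g := continuous_realization fun s =>
    (ContinuousMap.curry ⟨_, h s⟩).continuous
  exact ContinuousMap.continuous_uncurry_of_continuous ⟨g, hg⟩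

/-- A continuous injection into a quotient of a realization, or into such a quotient with additional
isolated points, is a homeomorphism, if every simplex is covered by a compact set of pairs of
corresponding points. -/
theorem isHomeomorph_of_compact_cover {Z Q : Type*} [TopologicalSpace Z] [TopologicalSpace Q]
    {π : K.Realization → Q} (hπ : ∀ C, IsClosed (π ⁻¹' C) → IsClosed C) {f : Z → Q}
    (hf : Continuous f) (hinj : Function.Injective f) (hsurj : ∀ q, q ∈ range π ∨ q ∈ range f)
    (hcov : ∀ s : K.faces, ∃ T : Set (Z × K.Realization), IsCompact T ∧
      (∀ p ∈ T, f p.1 = π p.2) ∧ ∀ x, x.1 ∈ closedSimplex s.1 → ∃ z, (z, x) ∈ T) :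
    IsHomeomorph f := by
  have hclosed : IsClosedMap f := by
    intro F hF
    refine hπ _ (isClosed_realization fun s => ?_)
    obtain ⟨T, hT, hTf, hTs⟩ := hcov s
    -- On the simplex, the preimage of `f '' F` is this compact set, because injectivity of `f`
    -- makes the partner in `T` the only possible one.
    have hK : IsCompact (Prod.snd '' (T ∩ Prod.fst ⁻¹' F)) :=
      (hT.inter_right (hF.preimage continuous_fst)).image continuous_snd
    convert hK.isClosed.preimage (continuous_simplexInclusion s) using 1
    ext x
    constructor
    · rintro ⟨z, hz, hzx⟩
      obtain ⟨z', hz'⟩ := hTs (K.simplexInclusion s x) x.2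
      have : z' = z := hinj ((hTf _ hz').trans hzx.symm)
      exact ⟨_, ⟨hz', by simpa [this] using hz⟩, rfl⟩
    · rintro ⟨p, ⟨hpT, hpF⟩, hp⟩
      exact ⟨p.1, hpF, by rw [hTf p hpT, hp]⟩
  refine isHomeomorph_iff_continuous_isClosedMap_bijective.2 ⟨hf, hclosed, hinj, fun q => ?_⟩
  obtain ⟨⟨x, s, hs, hx⟩, rfl⟩ | hq := hsurj q
  swap
  · exact hq
  obtain ⟨T, -, hTf, hTs⟩ := hcov ⟨s, hs⟩
  obtain ⟨z, hz⟩ := hTs ⟨x, s, hs, hx⟩ hx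
  exact ⟨z, hTf _ hz⟩

theorem realization_nonneg (x : K.Realization) (v : V) : 0 ≤ x.1 v := by
  obtain ⟨_, s, -, hx⟩ := x
  exact hx.1 v

theorem exists_mem_eq_zero {ρ : Finset V} (hK : ∀ t ∈ K.faces, ¬ ρ ⊆ t) (a : K.Realization) :
    ∃ v ∈ ρ, a.1 v = 0 := by
  obtain ⟨_, s, hs, hx⟩ := a
  obtain ⟨v, hv, hvs⟩ := Finset.not_subset.1 (hK s hs)
  exact ⟨v, hv, hx.2.1 v hvs⟩

/-! ### Cones with apex a barycenter -/

section Cone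

variable [DecidableEq V] {A : PreAbstractSimplicialComplex V} {ρ : Finset V}

/-- The map `(a, t) ↦ t • barycenter ρ + (1 - t) • a` from `|A| × [0,1]` to `|K|`. -/
noncomputable def coneMap (hρ : ρ.Nonempty) (h : ∀ t ∈ A.faces, t ∪ ρ ∈ K.faces)
    (p : A.Realization × unitInterval) : K.Realization :=
  ⟨(p.2 : ℝ) • barycenter ρ + (1 - (p.2 : ℝ)) • p.1.1, by
    obtain ⟨s, hs, hx⟩ := p.1.2
    exact ⟨s ∪ ρ, h s hs, mem_closedSimplex_union hx (barycenter_mem hρ) p.2⟩⟩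

theorem continuous_coneMap (hρ : ρ.Nonempty) (h : ∀ t ∈ A.faces, t ∪ ρ ∈ K.faces) :
    Continuous (coneMap hρ h) := by
  refine continuous_realization_prod fun s => ?_
  refine (continuous_simplexInclusion (K := K) ⟨s.1 ∪ ρ, h s s.2⟩).comp
    (f := fun p : closedSimplex s.1 × unitInterval =>
      (⟨(p.2 : ℝ) • barycenter ρ + (1 - (p.2 : ℝ)) • p.1.1,
        mem_closedSimplex_union p.1.2 (barycenter_mem hρ) p.2⟩ : closedSimplex (s.1 ∪ ρ))) ?_
  exact Continuous.subtype_mk (by fun_prop) _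

theorem coneMap_zero (hρ : ρ.Nonempty) (h : ∀ t ∈ A.faces, t ∪ ρ ∈ K.faces) (a : A.Realization) :
    (coneMap hρ h (a, 0)).1 = a.1 := by
  simp [coneMap]

theorem coneMap_one (hρ : ρ.Nonempty) (h : ∀ t ∈ A.faces, t ∪ ρ ∈ K.faces) (a : A.Realization) :
    (coneMap hρ h (a, 1)).1 = barycenter ρ := by
  simp [coneMap]

theorem coneMap_inj (hρ : ρ.Nonempty) (h : ∀ t ∈ A.faces, t ∪ ρ ∈ K.faces)
    (hA : ∀ t ∈ A.faces, ¬ ρ ⊆ t) {a a' : A.Realization} {t t' : unitInterval} (ht : t < 1)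
    (he : coneMap hρ h (a, t) = coneMap hρ h (a', t')) : a = a' ∧ t = t' := by
  obtain ⟨h1, h2⟩ := cone_coord_unique (realization_nonneg a) (realization_nonneg a')
    (exists_mem_eq_zero hA a) (exists_mem_eq_zero hA a') (Subtype.coe_lt_coe.2 ht) t'.2.2
    (congrArg Subtype.val he)
  exact ⟨Subtype.ext h2, Subtype.ext h1⟩

theorem coneMap_ne_barycenter (hρ : ρ.Nonempty) (h : ∀ t ∈ A.faces, t ∪ ρ ∈ K.faces)
    (hA : ∀ t ∈ A.faces, ¬ ρ ⊆ t) (a : A.Realization) {t : unitInterval} (ht : t < 1) :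
    (coneMap hρ h (a, t)).1 ≠ barycenter ρ := by
  intro he
  have := (coneMap_inj hρ h hA ht (Subtype.ext (he.trans (coneMap_one hρ h a).symm))).2
  exact ht.ne this

theorem coneMap_pos (hρ : ρ.Nonempty) (h : ∀ t ∈ A.faces, t ∪ ρ ∈ K.faces) (a : A.Realization)
    {t : unitInterval} (ht : 0 < t) {v : V} (hv : v ∈ ρ) : 0 < (coneMap hρ h (a, t)).1 v := by
  have h1 := mul_pos (Subtype.coe_lt_coe.2 ht) (barycenter_pos hv)
  have h2 := mul_nonneg (sub_nonneg.2 t.2.2) (realization_nonneg a v)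
  exact add_pos_of_pos_of_nonneg h1 h2

theorem coneMap_eq_zero (hρ : ρ.Nonempty) (h : ∀ t ∈ A.faces, t ∪ ρ ∈ K.faces) (a : A.Realization)
    (t : unitInterval) {v : V} (hv : v ∉ ρ) (ha : a.1 v = 0) :
    (coneMap hρ h (a, t)).1 v = 0 := by
  simp [coneMap, barycenter_of_notMem hv, ha]

/-- Points of a cone are determined by their images under the cone map. -/
theorem eq_of_coneMap_eq {Z : Type*} (hρ : ρ.Nonempty) (h : ∀ t ∈ A.faces, t ∪ ρ ∈ K.faces)
    (hA : ∀ t ∈ A.faces, ¬ ρ ⊆ t) {c : A.Realization × unitInterval → Z} {n p q : Z}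
    {x : K.Realization}
    (hp : (p = n ∧ x.1 = barycenter ρ) ∨ ∃ a t, t < 1 ∧ p = c (a, t) ∧ x = coneMap hρ h (a, t))
    (hq : (q = n ∧ x.1 = barycenter ρ) ∨ ∃ a t, t < 1 ∧ q = c (a, t) ∧ x = coneMap hρ h (a, t)) :
    p = q := by
  rcases hp with ⟨rfl, hx⟩ | ⟨a, t, ht, rfl, rfl⟩ <;>
    rcases hq with ⟨rfl, hx'⟩ | ⟨a', t', ht', rfl, hx'⟩
  · rfl
  · exact absurd (hx' ▸ hx) (coneMap_ne_barycenter hρ h hA a' ht')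
  · exact absurd hx' (coneMap_ne_barycenter hρ h hA a ht)
  · obtain ⟨rfl, rfl⟩ := coneMap_inj hρ h hA ht hx'
    rfl

/-- The compact set of pairs used to cover a simplex containing `ρ`. -/
theorem exists_compact_cover_cone {Z : Type*} [TopologicalSpace Z] (hρ : ρ.Nonempty)
    (h : ∀ t ∈ A.faces, t ∪ ρ ∈ K.faces) {s : Finset V} (hs : s ∈ K.faces) (hρs : ρ ⊆ s)
    (hface : ∀ v ∈ ρ, (s.erase v).Nonempty → s.erase v ∈ A.faces)
    {c : A.Realization × unitInterval → Z} (hc : Continuous c) (n : Z) :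
    ∃ T : Set (Z × K.Realization), IsCompact T ∧
      (∀ p ∈ T, (∃ q, p = (c q, coneMap hρ h q)) ∨ (p.1 = n ∧ p.2.1 = barycenter ρ)) ∧
      ∀ x, x.1 ∈ closedSimplex s → ∃ z, (z, x) ∈ T := by
  let b : K.Realization := ⟨barycenter ρ, s, hs, closedSimplex_mono hρs (barycenter_mem hρ)⟩
  let T₀ : ∀ t : A.faces, Set (Z × K.Realization) := fun t =>
    range fun q : closedSimplex t.1 × unitInterval =>
      (c (A.simplexInclusion t q.1, q.2), coneMap hρ h (A.simplexInclusion t q.1, q.2))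
  have hT₀ : ∀ t, IsCompact (T₀ t) := fun t => by
    have hi : Continuous fun q : closedSimplex t.1 × unitInterval =>
        (A.simplexInclusion t q.1, q.2) :=
      ((continuous_simplexInclusion t).comp continuous_fst).prodMk continuous_snd
    exact isCompact_range ((hc.comp hi).prodMk ((continuous_coneMap hρ h).comp hi))
  -- A simplex has finitely many faces, so finitely many compact cones, plus the apex, cover it. The
  -- apex is added separately because `A` may be empty.
  have hfin : {t : A.faces | t.1 ⊆ s}.Finite :=
    (s.powerset.finite_toSet.preimage Subtype.val_injective.injOn).subset fun t ht => by
      simpa using ht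
  refine ⟨(⋃ t ∈ {t : A.faces | t.1 ⊆ s}, T₀ t) ∪ {(n, b)},
    (hfin.isCompact_biUnion fun t _ => hT₀ t).union isCompact_singleton, ?_, ?_⟩
  · rintro p (hp | rfl)
    · simp only [mem_iUnion] at hp
      obtain ⟨t, -, q, rfl⟩ := hp
      exact .inl ⟨_, rfl⟩
    · exact .inr ⟨rfl, rfl⟩
  · rintro x hx
    rcases exists_cone_coord hρ hρs hx with hxb | ⟨v, hv, a, ha, t, hxt⟩
    · exact ⟨n, .inr (Prod.ext rfl (Subtype.ext hxb))⟩
    · have hne : (s.erase v).Nonempty := by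
        rw [Finset.nonempty_iff_ne_empty]
        intro he
        rw [he] at ha
        simpa using ha.2.2
      refine ⟨_, .inl (mem_biUnion (x := ⟨s.erase v, hface v hv hne⟩) (s.erase_subset v)
        ⟨(⟨a, ha⟩, t), Prod.ext rfl (Subtype.ext hxt.symm)⟩)⟩

end Cone

end PreAbstractSimplicialComplex

/-! ### Unreduced suspensions -/

section Suspension

variable {L : TopCat.{u}}

/-- The point of the suspension at height `p.2` over `p.1`. -/
def suspensionMk (p : L × unitInterval) : suspension L := Quot.mk (SuspensionRel L) (Sum.inl p)

/-- The north pole of the suspension. -/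
def northPole (L : TopCat.{u}) : suspension L := Quot.mk (SuspensionRel L) (Sum.inr true)

theorem continuous_suspensionMk : Continuous (suspensionMk (L := L)) :=
  continuous_quot_mk.comp continuous_inl

theorem suspensionMk_zero (z : L) : suspensionMk (z, 0) = southPole L :=
  Quot.sound (SuspensionRel.south z)

theorem suspensionMk_one (z : L) : suspensionMk (z, 1) = northPole L :=
  Quot.sound (SuspensionRel.north z)

theorem suspension_cases (p : suspension L) :
    p = southPole L ∨ p = northPole L ∨ ∃ z t, 0 < t ∧ t < 1 ∧ p = suspensionMk (z, t) := by
  obtain ⟨⟨z, t⟩ | b, rfl⟩ := Quot.exists_rep p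
  · rcases eq_or_ne t 0 with rfl | h0
    · exact .inl (suspensionMk_zero z)
    rcases eq_or_ne t 1 with rfl | h1
    · exact .inr (.inl (suspensionMk_one z))
    · exact .inr (.inr ⟨z, t, unitInterval.pos_iff_ne_zero.2 h0, unitInterval.lt_one_iff_ne_one.2 h1,
        rfl⟩)
  · cases b
    · exact .inl rfl
    · exact .inr (.inl rfl)

/-- A map out of the suspension, given by its values on the cylinder and at the poles. -/
def suspensionLift {W : Type*} (f : L × unitInterval → W) (s n : W) (h0 : ∀ z, f (z, 0) = s)
    (h1 : ∀ z, f (z, 1) = n) : suspension L → W :=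
  Quot.lift (Sum.elim f fun b => bif b then n else s) (by
    rintro _ _ (z | z)
    · exact h0 z
    · exact h1 z)

theorem continuous_suspensionLift {W : Type*} [TopologicalSpace W] {f : L × unitInterval → W}
    (hf : Continuous f) (s n : W) (h0 : ∀ z, f (z, 0) = s) (h1 : ∀ z, f (z, 1) = n) :
    Continuous (suspensionLift f s n h0 h1) :=
  continuous_quot_lift _ (hf.sumElim continuous_of_discreteTopology)

end Suspension

/-! ### The join of the boundary with the link as an iterated suspension -/

namespace PreAbstractSimplicialComplex

variable {V : Type u} [DecidableEq V]

/-- For `ρ ⊆ σ`, the join of the boundary of `ρ` with the link of `σ` in `X`. -/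
def boundaryJoinLink (X : PreAbstractSimplicialComplex V) (σ ρ : Finset V) :
    PreAbstractSimplicialComplex V where
  faces := {t | t.Nonempty ∧ t ∪ σ ∈ X.faces ∧ t ∩ σ ⊆ ρ ∧ ¬ ρ ⊆ t}
  isRelLowerSet_faces := by
    rintro t ⟨ht, htX, hts, htr⟩
    refine ⟨ht, fun r hrt hr => ⟨hr, ?_, ?_, fun h => htr (h.trans hrt)⟩⟩
    · exact (X.isRelLowerSet_faces htX).2 (Finset.union_subset_union_left hrt)
        (hr.mono Finset.subset_union_left)
    · exact (Finset.inter_subset_inter_right hrt).trans hts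

theorem boundaryJoinLink_singleton (X : PreAbstractSimplicialComplex V) {σ : Finset V} {v : V}
    (hv : v ∈ σ) : X.boundaryJoinLink σ {v} = X.link σ := by
  ext t
  change (t.Nonempty ∧ t ∪ σ ∈ X.faces ∧ t ∩ σ ⊆ {v} ∧ ¬ {v} ⊆ t) ↔
    (t ∈ X.faces ∧ Disjoint t σ ∧ t ∪ σ ∈ X.faces)
  constructor
  · rintro ⟨ht, htX, hts, hvt⟩
    refine ⟨(X.isRelLowerSet_faces htX).2 Finset.subset_union_left ht, ?_, htX⟩
    rw [Finset.disjoint_left]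
    intro w hwt hws
    have := Finset.mem_singleton.1 (hts (Finset.mem_inter.2 ⟨hwt, hws⟩))
    subst this
    exact hvt (Finset.singleton_subset_iff.2 hwt)
  · rintro ⟨htX, hd, hu⟩
    refine ⟨(X.isRelLowerSet_faces htX).1, hu, ?_, fun h => ?_⟩
    · simp [Finset.disjoint_iff_inter_eq_empty.1 hd]
    · exact Finset.disjoint_left.1 hd (h (Finset.mem_singleton_self v)) hv

/-- Adding a vertex to `ρ` suspends the join of its boundary with the link: the result is the union
of the cone with apex the new vertex and the cone with apex the barycenter of `ρ`. -/
theorem nonempty_suspension_homeomorph {X : PreAbstractSimplicialComplex V} {σ ρ : Finset V} {v : V}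
    (hσ : σ ∈ X.faces) (hρ : ρ.Nonempty) (hv : v ∉ ρ) (hρσ : insert v ρ ⊆ σ) {Z : TopCat.{u}}
    (e : Z ≃ₜ (X.boundaryJoinLink σ ρ).Realization) :
    Nonempty (suspension Z ≃ₜ (X.boundaryJoinLink σ (insert v ρ)).Realization) := by
  set A := X.boundaryJoinLink σ ρ with hA
  set K := X.boundaryJoinLink σ (insert v ρ) with hK
  have hvσ : v ∈ σ := hρσ (Finset.mem_insert_self v ρ)
  have hsub : ρ ⊆ σ := (Finset.subset_insert v ρ).trans hρσ
  have hvA : ∀ t ∈ A.faces, v ∉ t := fun t ht hvt =>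
    hv (ht.2.2.1 (Finset.mem_inter.2 ⟨hvt, hvσ⟩))
  have hvA' : ∀ t ∈ A.faces, ¬ {v} ⊆ t := fun t ht h =>
    hvA t ht (Finset.singleton_subset_iff.1 h)
  have hρA : ∀ t ∈ A.faces, ¬ ρ ⊆ t := fun t ht => ht.2.2.2
  have hvK : ∀ t ∈ A.faces, t ∪ {v} ∈ K.faces := by
    rintro t ⟨h1, h2, h3, h4⟩
    refine ⟨h1.mono Finset.subset_union_left, ?_, ?_, ?_⟩
    · rwa [Finset.union_assoc, Finset.union_eq_right.2 (Finset.singleton_subset_iff.2 hvσ)]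
    · grind
    · grind
  have hρK : ∀ t ∈ A.faces, t ∪ ρ ∈ K.faces := by
    rintro t ht
    have hvt := hvA t ht
    obtain ⟨h1, h2, h3, h4⟩ := ht
    refine ⟨h1.mono Finset.subset_union_left, ?_, ?_, ?_⟩
    · rwa [Finset.union_assoc, Finset.union_eq_right.2 hsub]
    · grind
    · grind
  have hvne := Finset.singleton_nonempty v
  let S : K.Realization := ⟨barycenter {v}, {v}, ⟨hvne, by
    rwa [Finset.union_eq_right.2 (Finset.singleton_subset_iff.2 hvσ)], by grind, by
    obtain ⟨w, hw⟩ := hρ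
    grind⟩, barycenter_mem hvne⟩
  let N : K.Realization := ⟨barycenter ρ, ρ, ⟨hρ, by
    rwa [Finset.union_eq_right.2 hsub], by grind, by grind⟩, barycenter_mem hρ⟩
  -- The lower half of the suspension goes to the cone with apex `v`, the upper half to the cone
  -- with apex the barycenter of `ρ`; height `1/2` is the common base. `down` and `up` below are
  -- right inverses of `lo` and `hi`.
  let lo : unitInterval → unitInterval := fun t => projIcc (0 : ℝ) 1 zero_le_one (1 - 2 * t)
  let hi : unitInterval → unitInterval := fun t => projIcc (0 : ℝ) 1 zero_le_one (2 * t - 1)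
  have hlo : Continuous lo := continuous_projIcc.comp (by fun_prop)
  have hhi : Continuous hi := continuous_projIcc.comp (by fun_prop)
  let φ : Z × unitInterval → K.Realization := fun p =>
    if (p.2 : ℝ) ≤ 1 / 2 then coneMap hvne hvK (e p.1, lo p.2) else coneMap hρ hρK (e p.1, hi p.2)
  have hφ : Continuous φ := by
    refine Continuous.if_le ?_ ?_ (by fun_prop) continuous_const ?_
    · exact (continuous_coneMap hvne hvK).comp (by fun_prop)
    · exact (continuous_coneMap hρ hρK).comp (by fun_prop)
    · rintro ⟨z, t⟩ (ht : (t : ℝ) = 1 / 2)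
      have h1 : lo t = 0 := projIcc_of_le_left _ (by rw [ht]; norm_num)
      have h2 : hi t = 0 := projIcc_of_le_left _ (by rw [ht]; norm_num)
      simp only [h1, h2]
      exact Subtype.ext ((coneMap_zero hvne hvK _).trans (coneMap_zero hρ hρK _).symm)
  have hφ0 : ∀ z, φ (z, 0) = S := fun z => by
    have h1 : lo 0 = 1 := projIcc_of_right_le _ (by simp)
    have : φ (z, 0) = coneMap hvne hvK (e z, lo 0) := if_pos (by simp)
    rw [this, h1]
    exact Subtype.ext (coneMap_one hvne hvK _)
  have hφ1 : ∀ z, φ (z, 1) = N := fun z => by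
    have h1 : hi 1 = 1 := projIcc_of_right_le _ (by norm_num)
    have : φ (z, 1) = coneMap hρ hρK (e z, hi 1) := if_neg (by norm_num)
    rw [this, h1]
    exact Subtype.ext (coneMap_one hρ hρK _)
  let f : suspension Z → K.Realization := suspensionLift φ S N hφ0 hφ1
  have hf : Continuous f := continuous_suspensionLift hφ S N hφ0 hφ1
  let up : unitInterval → unitInterval := fun t => ⟨(1 + t) / 2, by
    have := t.2.1; have := t.2.2; constructor <;> linarith⟩
  let down : unitInterval → unitInterval := fun t => ⟨(1 - t) / 2, by
    have := t.2.1; have := t.2.2; constructor <;> linarith⟩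
  have hup : Continuous up := Continuous.subtype_mk (by fun_prop) _
  have hdown : Continuous down := Continuous.subtype_mk (by fun_prop) _
  let cu : A.Realization × unitInterval → suspension Z := fun p => suspensionMk (e.symm p.1, up p.2)
  let cd : A.Realization × unitInterval → suspension Z := fun p =>
    suspensionMk (e.symm p.1, down p.2)
  have hcu : Continuous cu := continuous_suspensionMk.comp (by fun_prop)
  have hcd : Continuous cd := continuous_suspensionMk.comp (by fun_prop)
  have hfd : ∀ p, f (cd p) = coneMap hvne hvK p := by
    rintro ⟨a, t⟩
    have h1 : lo (down t) = t := by
      have : (1 - 2 * (down t : ℝ)) = t := by simp only [down]; ring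
      simp only [lo, this, projIcc_val]
    have : f (cd (a, t)) = coneMap hvne hvK (e (e.symm a), lo (down t)) :=
      if_pos (by have := t.2.1; simp only [down]; linarith)
    rw [this, h1, e.apply_symm_apply]
  have hfu : ∀ p, f (cu p) = coneMap hρ hρK p := by
    rintro ⟨a, t⟩
    -- Height `up 0 = 1/2` falls under the lower branch of `φ`.
    rcases eq_or_ne t 0 with rfl | ht
    · have : cu (a, 0) = cd (a, 0) := by simp [cu, cd, up, down]
      rw [this, hfd]
      exact Subtype.ext ((coneMap_zero hvne hvK _).trans (coneMap_zero hρ hρK _).symm)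
    have h1 : hi (up t) = t := by
      have : (2 * (up t : ℝ) - 1) = t := by simp only [up]; ring
      simp only [hi, this, projIcc_val]
    have : f (cu (a, t)) = coneMap hρ hρK (e (e.symm a), hi (up t)) := if_neg (by
      have : (0 : ℝ) < t := Subtype.coe_lt_coe.2 (unitInterval.pos_iff_ne_zero.2 ht)
      simp only [up]; linarith)
    rw [this, h1, e.apply_symm_apply]
  have hav : ∀ a : A.Realization, a.1 v = 0 := by
    rintro ⟨a, s, hs, ha⟩
    exact ha.2.1 v (hvA s hs)
  -- The image tells the halves apart: all `ρ`-coordinates are positive exactly on the strict upper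
  -- half. Injectivity thus reduces to a single cone.
  have hcases : ∀ p : suspension Z,
      (((p = southPole Z ∧ (f p).1 = barycenter {v}) ∨
        ∃ a t, t < 1 ∧ p = cd (a, t) ∧ f p = coneMap hvne hvK (a, t)) ∧
          ∃ w ∈ ρ, (f p).1 w = 0) ∨
      (((p = northPole Z ∧ (f p).1 = barycenter ρ) ∨
        ∃ a t, t < 1 ∧ p = cu (a, t) ∧ f p = coneMap hρ hρK (a, t)) ∧
          ∀ w ∈ ρ, 0 < (f p).1 w) := by
    intro p
    rcases suspension_cases p with rfl | rfl | ⟨z, t, ht0, ht1, rfl⟩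
    · obtain ⟨w, hw⟩ := hρ
      exact .inl ⟨.inl ⟨rfl, rfl⟩, w, hw, barycenter_of_notMem (by grind)⟩
    · exact .inr ⟨.inl ⟨rfl, rfl⟩, fun w hw => barycenter_pos hw⟩
    · have h0 : (0 : ℝ) < t := ht0
      have h1 : (t : ℝ) < 1 := ht1
      rcases le_or_gt (t : ℝ) (1 / 2) with ht | ht
      · left
        have hp : suspensionMk (z, t) = cd (e z, ⟨1 - 2 * t, by linarith, by linarith⟩) := by
          simp only [cd, e.symm_apply_apply]
          congr 2
          exact Subtype.ext (by simp only [down]; ring)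
        refine ⟨.inr ⟨_, _, ?_, hp, hp ▸ hfd _⟩, ?_⟩
        · exact Subtype.coe_lt_coe.1 (by change 1 - 2 * (t : ℝ) < 1; linarith)
        · obtain ⟨w, hw, hw0⟩ := exists_mem_eq_zero hρA (e z)
          rw [hp, hfd]
          exact ⟨w, hw, coneMap_eq_zero hvne hvK _ _ (by grind) hw0⟩
      · right
        have hp : suspensionMk (z, t) = cu (e z, ⟨2 * t - 1, by linarith, by linarith⟩) := by
          simp only [cu, e.symm_apply_apply]
          congr 2
          exact Subtype.ext (by simp only [up]; ring)
        refine ⟨.inr ⟨_, _, ?_, hp, hp ▸ hfu _⟩, fun w hw => ?_⟩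
        · exact Subtype.coe_lt_coe.1 (by change 2 * (t : ℝ) - 1 < 1; linarith)
        · rw [hp, hfu]
          exact coneMap_pos hρ hρK _
            (Subtype.coe_lt_coe.1 (by change 0 < 2 * (t : ℝ) - 1; linarith)) hw
  have hinj : Function.Injective f := by
    intro p q hpq
    rcases hcases p with ⟨hp, w, hw, hw0⟩ | ⟨hp, hpos⟩ <;>
      rcases hcases q with ⟨hq, w', hw', hw0'⟩ | ⟨hq, hpos'⟩
    · rw [hpq] at hp
      exact eq_of_coneMap_eq hvne hvK hvA' hp hq
    · rw [hpq] at hw0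
      exact absurd hw0 (hpos' w hw).ne'
    · rw [← hpq] at hw0'
      exact absurd hw0' (hpos w' hw').ne'
    · rw [hpq] at hp
      exact eq_of_coneMap_eq hρ hρK hρA hp hq
  refine ⟨(isHomeomorph_of_compact_cover (π := id) (fun _ h => h) hf hinj
    (fun q => .inl ⟨q, rfl⟩) ?_).homeomorph⟩
  rintro ⟨s, hs⟩
  -- A simplex containing `ρ` misses `v` and lies in the upper cone. Otherwise `insert v s` is still
  -- a simplex of `K`, and it lies in the lower cone.
  by_cases hρs : ρ ⊆ s
  · have hvs : v ∉ s := fun hvs => hs.2.2.2 (Finset.insert_subset hvs hρs)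
    obtain ⟨T, hT, hTf, hTs⟩ := exists_compact_cover_cone hρ hρK hs hρs (fun w hw hne =>
      ⟨hne, (X.isRelLowerSet_faces hs.2.1).2 (by grind) (hne.mono Finset.subset_union_left), by
        have := hs.2.2.1
        grind, by grind⟩) hcu (northPole Z)
    refine ⟨T, hT, fun p hp => ?_, hTs⟩
    rcases hTf p hp with ⟨q, rfl⟩ | ⟨h1, h2⟩
    · exact hfu q
    · rw [h1]
      exact Subtype.ext h2.symm
  · have hs' : insert v s ∈ K.faces := ⟨Finset.insert_nonempty v s, by
      rw [Finset.insert_union, Finset.insert_eq_of_mem (Finset.mem_union_right s hvσ)]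
      exact hs.2.1, by
        have := hs.2.2.1
        grind, by grind⟩
    obtain ⟨T, hT, hTf, hTs⟩ := exists_compact_cover_cone hvne hvK hs'
      (Finset.singleton_subset_iff.2 (Finset.mem_insert_self v s)) (fun w hw hne => by
        obtain rfl := Finset.mem_singleton.1 hw
        refine ⟨hne, (X.isRelLowerSet_faces hs.2.1).2 (by grind)
          (hne.mono Finset.subset_union_left), ?_, ?_⟩
        · have := hs.2.2.1
          grind
        · grind) hcd (southPole Z)
    refine ⟨T, hT, fun p hp => ?_, fun x hx =>
      hTs x (closedSimplex_mono (Finset.subset_insert v s) hx)⟩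
    rcases hTf p hp with ⟨q, rfl⟩ | ⟨h1, h2⟩
    · exact hfd q
    · rw [h1]
      exact Subtype.ext h2.symm

/-- The induction enlarges `ρ` inside a fixed `σ`, so the link never changes. -/
theorem nonempty_iteratedSuspension_homeomorph {X : PreAbstractSimplicialComplex V} {σ : Finset V}
    (hσ : σ ∈ X.faces) {ρ : Finset V} (hρ : ρ.Nonempty) (hρσ : ρ ⊆ σ) :
    Nonempty (iteratedSuspension (simplexDim ρ) (TopCat.of (X.link σ).Realization) ≃ₜ
      (X.boundaryJoinLink σ ρ).Realization) := by
  induction hρ using Finset.Nonempty.cons_induction with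
  | singleton v =>
    rw [boundaryJoinLink_singleton X (Finset.singleton_subset_iff.1 hρσ)]
    exact ⟨Homeomorph.refl _⟩
  | cons v ρ hv hρ ih =>
    rw [Finset.cons_eq_insert] at hρσ ⊢
    obtain ⟨e⟩ := ih ((Finset.subset_insert v ρ).trans hρσ)
    have hd : simplexDim (insert v ρ) = simplexDim ρ + 1 := by
      have := hρ.card_pos
      simp only [simplexDim, Finset.card_insert_of_notMem hv]
      omega
    rw [hd]
    exact nonempty_suspension_homeomorph hσ hρ hv hρσ e

end PreAbstractSimplicialComplex

/-! ### Collapsed quotients -/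

section Collapse

variable {B : Type u} {A : Set B}

/-- The base point of `B / A`. -/
def Collapse.base (A : Set B) : Collapse A := Quot.mk _ (Sum.inr ())

/-- The quotient map to `B / A`. -/
def Collapse.mk (A : Set B) (b : B) : Collapse A := Quot.mk _ (Sum.inl b)

theorem Collapse.continuous_mk [TopologicalSpace B] : Continuous (Collapse.mk A) :=
  continuous_quot_mk.comp continuous_inl

theorem Collapse.mk_eq_base {b : B} (hb : b ∈ A) : Collapse.mk A b = Collapse.base A :=
  Quot.sound (CollapseRel.glue b hb)

theorem Collapse.cases (q : Collapse A) :
    q = Collapse.base A ∨ ∃ b, b ∉ A ∧ q = Collapse.mk A b := by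
  obtain ⟨b | _, rfl⟩ := Quot.exists_rep q
  · by_cases hb : b ∈ A
    · exact .inl (Collapse.mk_eq_base hb)
    · exact .inr ⟨b, hb, rfl⟩
  · exact .inl rfl

/-- A map out of `B / A`, given by a map out of `B` that sends `A` to a point. -/
def Collapse.lift {W : Type*} (f : B → W) (w : W) (h : ∀ b ∈ A, f b = w) : Collapse A → W :=
  Quot.lift (Sum.elim f fun _ => w) (by
    rintro _ _ ⟨b, hb⟩
    exact h b hb)

theorem Collapse.continuous_lift {W : Type*} [TopologicalSpace W] [TopologicalSpace B] {f : B → W}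
    (hf : Continuous f) (w : W) (h : ∀ b ∈ A, f b = w) : Continuous (Collapse.lift f w h) :=
  continuous_quot_lift _ (hf.sumElim continuous_const)

open Classical in
theorem Collapse.mk_inj {b b' : B} (hb : b ∉ A) (h : Collapse.mk A b = Collapse.mk A b') :
    b = b' := by
  let r : Collapse A → Option B :=
    Collapse.lift (fun b => if b ∈ A then none else some b) none fun b hb => if_pos hb
  have hr : (if b ∈ A then none else some b) = (if b' ∈ A then none else some b') := congrArg r h
  rw [if_neg hb] at hr
  split_ifs at hr
  exact Option.some.inj hr

open Classical in
theorem Collapse.mk_ne_base {b : B} (hb : b ∉ A) : Collapse.mk A b ≠ Collapse.base A := by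
  intro h
  let r : Collapse A → Option B :=
    Collapse.lift (fun b => if b ∈ A then none else some b) none fun b hb => if_pos hb
  have hr : (if b ∈ A then none else some b) = none := congrArg r h
  rw [if_neg hb] at hr
  exact Option.some_ne_none b hr

end Collapse

/-- The added point is a discrete summand before gluing, so it imposes no condition. -/
theorem Collapse.isClosed_of_preimage {B : Type u} [TopologicalSpace B] {A : Set B}
    {C : Set (Collapse A)} (h : IsClosed (Collapse.mk A ⁻¹' C)) : IsClosed C := by
  have hq : IsQuotientMap (Quot.mk (CollapseRel A)) := isQuotientMap_quot_mk
  refine hq.isClosed_preimage.1 (isClosed_sum_iff.2 ⟨h, isClosed_discrete _⟩)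

/-! ### The quotient as a wedge of suspensions -/

namespace PreAbstractSimplicialComplex

variable {V : Type u} [DecidableEq V]

theorem nonempty_wedge_homeomorph (X Y : PreAbstractSimplicialComplex V)
    (hYX : Y ≤ X) (S : Set (Finset V)) (hSX : S ⊆ X.faces)
    (hY : ∀ σ ∈ X.faces, σ ∈ Y.faces ↔ ∀ τ, τ ⊆ σ → τ ∉ S)
    (hS : ∀ σ ∈ S, ∀ τ ∈ S, σ ≠ τ → σ ∪ τ ∉ X.faces) (Z : S → TopCat.{u})
    (e : ∀ σ : S, Z σ ≃ₜ (X.boundaryJoinLink σ.1 σ.1).Realization) :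
    Nonempty (Wedge (fun σ => (suspension (Z σ) : Type u)) (fun σ => southPole (Z σ)) ≃ₜ
      Collapse (X.subRealization Y)) := by
  have hne : ∀ σ : S, σ.1.Nonempty := fun σ => (X.isRelLowerSet_faces (hSX σ.2)).1
  have hX : ∀ σ : S, ∀ t ∈ (X.boundaryJoinLink σ.1 σ.1).faces, t ∪ σ.1 ∈ X.faces :=
    fun _ _ ht => ht.2.1
  have hA : ∀ σ : S, ∀ t ∈ (X.boundaryJoinLink σ.1 σ.1).faces, ¬ σ.1 ⊆ t :=
    fun _ _ ht => ht.2.2.2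
  have huniq : ∀ s ∈ X.faces, ∀ σ τ : S, σ.1 ⊆ s → τ.1 ⊆ s → σ = τ := by
    intro s hs σ τ hσ hτ
    by_contra hστ
    exact hS σ.1 σ.2 τ.1 τ.2 (fun h => hστ (Subtype.ext h)) ((X.isRelLowerSet_faces hs).2
      (Finset.union_subset hσ hτ) ((hne σ).mono Finset.subset_union_left))
  -- A member of `S` inside `t` would share the simplex `t ∪ σ` with `σ`, hence equal `σ`; but `t`
  -- does not contain `σ`.
  have hAY : ∀ σ : S, ∀ a : (X.boundaryJoinLink σ.1 σ.1).Realization, a.1 ∈ Y.support := by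
    rintro σ ⟨a, t, ht, ha⟩
    have htX := (X.isRelLowerSet_faces ht.2.1).2 Finset.subset_union_left ht.1
    refine ⟨t, (hY t htX).2 fun τ hτ hτS => ?_, ha⟩
    have := huniq _ ht.2.1 ⟨τ, hτS⟩ σ (hτ.trans Finset.subset_union_left)
      Finset.subset_union_right
    exact hA σ t ht (this ▸ hτ)
  have hpos : ∀ {s : Finset V} {x : V → ℝ} {σ : S}, x ∈ closedSimplex s →
      (∀ v ∈ σ.1, 0 < x v) → σ.1 ⊆ s := by
    intro s x σ hx hσ v hv
    by_contra hvs
    exact (hσ v hv).ne' (hx.2.1 v hvs)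
  have hnotY : ∀ {x : X.Realization} {σ : S}, (∀ v ∈ σ.1, 0 < x.1 v) →
      x ∉ X.subRealization Y := by
    rintro x σ hσ ⟨s, hs, hx⟩
    exact (hY s (hYX hs)).1 hs σ.1 (hpos hx hσ) σ.2
  let base : Collapse (X.subRealization Y) := Collapse.base _
  let N : S → X.Realization := fun σ =>
    ⟨barycenter σ.1, σ.1, hSX σ.2, barycenter_mem (hne σ)⟩
  have hcyl : ∀ σ : S, Continuous fun p : Z σ × unitInterval =>
      Collapse.mk (X.subRealization Y) (coneMap (hne σ) (hX σ) (e σ p.1, p.2)) := fun σ =>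
    Collapse.continuous_mk.comp ((continuous_coneMap (hne σ) (hX σ)).comp (by fun_prop))
  have hbase : ∀ (σ : S) (a : (X.boundaryJoinLink σ.1 σ.1).Realization),
      Collapse.mk (X.subRealization Y) (coneMap (hne σ) (hX σ) (a, 0)) = base := fun σ a =>
    Collapse.mk_eq_base (by
      change (coneMap (hne σ) (hX σ) (a, 0)).1 ∈ Y.support
      rw [coneMap_zero]
      exact hAY σ a)
  have htop : ∀ (σ : S) (a : (X.boundaryJoinLink σ.1 σ.1).Realization),
      Collapse.mk (X.subRealization Y) (coneMap (hne σ) (hX σ) (a, 1)) = Collapse.mk _ (N σ) :=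
    fun σ a => congrArg _ (Subtype.ext (coneMap_one (hne σ) (hX σ) a))
  let φ : ∀ σ : S, suspension (Z σ) → Collapse (X.subRealization Y) := fun σ =>
    suspensionLift (fun p => Collapse.mk _ (coneMap (hne σ) (hX σ) (e σ p.1, p.2))) base
      (Collapse.mk _ (N σ)) (fun z => hbase σ (e σ z)) (fun z => htop σ (e σ z))
  have hφ : ∀ σ, Continuous (φ σ) := fun σ => continuous_suspensionLift (hcyl σ) _ _ _ _
  let B : Set (Σ σ : S, (suspension (Z σ) : Type u)) := range fun σ => ⟨σ, southPole (Z σ)⟩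
  let f : Collapse B → Collapse (X.subRealization Y) :=
    Collapse.lift (fun x => φ x.1 x.2) base (by rintro _ ⟨σ, rfl⟩; rfl)
  have hf : Continuous f := Collapse.continuous_lift (continuous_sigma hφ) _ _
  let c : ∀ σ : S, (X.boundaryJoinLink σ.1 σ.1).Realization × unitInterval → Collapse B :=
    fun σ p => Collapse.mk B ⟨σ, suspensionMk ((e σ).symm p.1, p.2)⟩
  have hc : ∀ σ, Continuous (c σ) := fun σ => Collapse.continuous_mk.comp
    (continuous_sigmaMk.comp (continuous_suspensionMk.comp (by fun_prop)))
  have hfc : ∀ σ p, f (c σ p) = Collapse.mk _ (coneMap (hne σ) (hX σ) p) := by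
    rintro σ ⟨a, t⟩
    change Collapse.mk _ (coneMap (hne σ) (hX σ) (e σ ((e σ).symm a), t)) = _
    rw [(e σ).apply_symm_apply]
  let n : S → Collapse B := fun σ => Collapse.mk B ⟨σ, northPole (Z σ)⟩
  -- Away from the base point, the image has a representative positive on all of `σ`. Such a point
  -- is outside `Y`, so its class determines it, and it determines `σ`.
  have hcases : ∀ p : Collapse B, p = Collapse.base B ∨ ∃ (σ : S) (x : X.Realization),
      f p = Collapse.mk _ x ∧ (∀ v ∈ σ.1, 0 < x.1 v) ∧
      ((p = n σ ∧ x.1 = barycenter σ.1) ∨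
        ∃ a t, t < 1 ∧ p = c σ (a, t) ∧ x = coneMap (hne σ) (hX σ) (a, t)) := by
    intro p
    rcases Collapse.cases p with rfl | ⟨⟨σ, q⟩, hq, rfl⟩
    · exact .inl rfl
    right
    rcases suspension_cases q with rfl | rfl | ⟨z, t, ht0, ht1, rfl⟩
    · exact absurd (mem_range_self σ) hq
    · exact ⟨σ, N σ, rfl, fun v hv => barycenter_pos hv, .inl ⟨rfl, rfl⟩⟩
    · refine ⟨σ, coneMap (hne σ) (hX σ) (e σ z, t), rfl,
        fun v hv => coneMap_pos (hne σ) (hX σ) _ ht0 hv, .inr ⟨_, _, ht1, ?_, rfl⟩⟩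
      simp only [c, (e σ).symm_apply_apply]
  have hinj : Function.Injective f := by
    intro p q hpq
    rcases hcases p with rfl | ⟨σ, x, hfx, hx, hp⟩ <;>
      rcases hcases q with rfl | ⟨τ, y, hfy, hy, hq⟩
    · rfl
    · exact absurd (hfy.symm.trans hpq.symm) (Collapse.mk_ne_base (hnotY hy))
    · exact absurd (hfx.symm.trans hpq) (Collapse.mk_ne_base (hnotY hx))
    · obtain rfl := Collapse.mk_inj (hnotY hx) (hfx.symm.trans (hpq.trans hfy))
      obtain ⟨_, s, hs, hxs⟩ := x
      obtain rfl := huniq s hs σ τ (hpos hxs hx) (hpos hxs hy)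
      exact eq_of_coneMap_eq (hne σ) (hX σ) (hA σ) hp hq
  refine ⟨(isHomeomorph_of_compact_cover (fun _ => Collapse.isClosed_of_preimage) hf hinj
    (fun q => ?_) ?_).homeomorph⟩
  -- If `Y` is empty, the base point does not come from `X`; it is hit by the base point of the
  -- wedge.
  · rcases Collapse.cases q with rfl | ⟨x, -, rfl⟩
    · exact .inr ⟨Collapse.base B, rfl⟩
    · exact .inl ⟨x, rfl⟩
  rintro ⟨s, hs⟩
  by_cases hsY : s ∈ Y.faces
  · refine ⟨range fun x : closedSimplex s => (Collapse.base B, X.simplexInclusion ⟨s, hs⟩ x),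
      isCompact_range (continuous_const.prodMk (continuous_simplexInclusion _)), ?_, ?_⟩
    · rintro _ ⟨x, rfl⟩
      have hx : X.simplexInclusion ⟨s, hs⟩ x ∈ X.subRealization Y := ⟨s, hsY, x.2⟩
      exact (Collapse.mk_eq_base hx).symm
    · exact fun x hx => ⟨_, ⟨x.1, hx⟩, rfl⟩
  · rw [hY s hs] at hsY
    push Not at hsY
    obtain ⟨σ, hσs, hσS⟩ := hsY
    obtain ⟨T, hT, hTf, hTs⟩ := exists_compact_cover_cone (hne ⟨σ, hσS⟩) (hX ⟨σ, hσS⟩) hs hσs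
      (fun v hv hn => ⟨hn, (X.isRelLowerSet_faces hs).2 (by grind)
        (hn.mono Finset.subset_union_left), Finset.inter_subset_right, by grind⟩)
      (hc ⟨σ, hσS⟩) (n ⟨σ, hσS⟩)
    refine ⟨T, hT, fun p hp => ?_, hTs⟩
    rcases hTf p hp with ⟨q, rfl⟩ | ⟨h1, h2⟩
    · exact hfc _ q
    · rw [h1]
      exact congrArg (Collapse.mk _) (Subtype.ext h2.symm)

end PreAbstractSimplicialComplex

theorem mainTheorem10 {V : Type u} [DecidableEq V] (X Y : PreAbstractSimplicialComplex V)
    (hYX : Y ≤ X) (S : Set (Finset V)) (hSX : S ⊆ X.faces)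
    (hY : ∀ σ ∈ X.faces, σ ∈ Y.faces ↔ ∀ τ, τ ⊆ σ → τ ∉ S)
    (hS : ∀ σ ∈ S, ∀ τ ∈ S, σ ≠ τ → σ ∪ τ ∉ X.faces) :
    Nonempty (ContinuousMap.HomotopyEquiv
      (Collapse (X.subRealization Y))
      (Wedge
        (fun σ : S => iteratedSuspension (PreAbstractSimplicialComplex.simplexDim σ.1 + 1)
          (TopCat.of (X.link σ.1).Realization))
        (fun σ : S => southPole (iteratedSuspension (PreAbstractSimplicialComplex.simplexDim σ.1)
          (TopCat.of (X.link σ.1).Realization))))) := by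
  let e := fun σ : S => (PreAbstractSimplicialComplex.nonempty_iteratedSuspension_homeomorph
    (hSX σ.2) (X.isRelLowerSet_faces (hSX σ.2)).1 (Finset.Subset.refl σ.1)).some
  -- The suspension formed here is, by definition, the last of the `dim σ + 1` suspensions.
  obtain ⟨h⟩ := PreAbstractSimplicialComplex.nonempty_wedge_homeomorph X Y hYX S hSX hY hS _ e
  exact ⟨h.symm.toHomotopyEquiv⟩
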